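/- Let $K=\mathrm{GF}(3^2)$ and let $\zeta\in K$ satisfy $\zeta^2=1-\zeta$. Let $\mathrm{M}(3^2)$ be the group of all permutations of $\mathbb{P}^1(K)=K\cup\{\infty\}$ of the form $\omega\mapsto\frac{r\beta(\omega)+s}{t\beta(\omega)+u}$ with $r,s,t,u\in K$, $\Delta=ru-st\neq0$, where $\beta$ is the identity if $\Delta$ is a square in $K^\times$, and $\beta(\omega)=\omega^3$ (with $\beta(\infty)=\infty$) otherwise. Let $v\notin\mathbb{P}^1(K)$ be a new point, let $\mathrm{M}(3^2)$ act on the eleven points $\mathbb{P}^1(K)\cup\{v\}$ by fixing $v$, and let $S_4$ be the permutation of these points given by $S_4(\infty)=v$, $S_4(v)=\infty$, and $S_4(x+\zeta y)=x-\zeta y$ for $x,y\in\mathrm{GF}(3)$. The Mathieu group $M_{11}$ is the permutation group $\langle \mathrm{M}(3^2),S_4\rangle$ of degree $11$ (permutations are composed as maps acting from the left). Write $[x,y]=xyx^{-1}y^{-1}$ and $x^y=y^{-1}xy$. Then $M_{11}$ has a presentation with generators $a,T,J,U$ and defining relations $$T^2=J^2=(JT)^3=(Ta^2)^3=[J,a]^4=(J[J,a])^2=1,\quad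 a^2=[J,a]^2,\quad (aT)^2=T^{[J,a]}$$ (the relations of $\mathrm{M}(3^2)$), together with $$U^2=(UT)^2=(UJ)^3=1,\quad a^U=[J,a],$$ where $a,T,J$ correspond to the elements $a:\omega\mapsto\zeta^{-1}\omega^3$, $T:\omega\mapsto1-\omega$, $J:\omega\mapsto\omega^{-1}$ of $\mathrm{M}(3^2)$ (fixing $v$), and $U$ corresponds to $S_4$. -/

import Mathlib

noncomputable section

namespace Mathieu

/-- The field `K = GF(3^2)`. -/
abbrev K : Type := GaloisField 3 2

/-- The projective line `ℙ¹(K) = K ∪ {∞}`, on which `GL₂(K)` acts by Möbius transformations. -/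
abbrev Line : Type := OnePoint K

/-- The set `ℙ¹(K) ∪ {v}` of eleven points; the new point `v` is `Option.none`. -/
abbrev Points : Type := Option Line

/-- The involutory field automorphism `ω ↦ ω³` of `K`. -/
def conj : K →+* K := frobenius K 3

lemma conj_conj (x : K) : conj (conj x) = x := by
  have hc : Nat.card K = 9 := by
    have := GaloisField.card 3 2 (by norm_num)
    norm_num at this
    exact this
  have : Fintype K := Fintype.ofFinite K
  have h := FiniteField.pow_card x
  rw [← Nat.card_eq_fintype_card, hc] at h
  simp only [conj, frobenius_def, ← pow_mul]
  exact h

open scoped Classical in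
/-- The map `β` attached to a matrix `A`: the identity on `ℙ¹(K)` if `det A` is a square in `Kˣ`,
and the map `ω ↦ ω³`, `∞ ↦ ∞` otherwise. -/
def twist (A : GL (Fin 2) K) (ω : Line) : Line :=
  if IsSquare (Matrix.GeneralLinearGroup.det A) then ω else OnePoint.map conj ω

lemma map_conj_conj (ω : Line) : OnePoint.map conj (OnePoint.map conj ω) = ω := by
  cases ω with
  | none => rfl
  | some x => exact congrArg OnePoint.some (conj_conj x)

lemma isSquare_mul_iff (x y : Kˣ) : IsSquare (x * y) ↔ (IsSquare x ↔ IsSquare y) := by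
  have : Fintype K := Fintype.ofFinite K
  classical
  have hF : ringChar K ≠ 2 := by
    rw [ringChar.eq K 3]
    decide
  have key : ∀ z : Kˣ, IsSquare z ↔ quadraticChar K (z : K) = 1 := by
    intro z
    rw [quadraticChar_one_iff_isSquare z.ne_zero]
    constructor
    · rintro ⟨w, rfl⟩
      exact ⟨w, by simp⟩
    · rintro ⟨w, hw⟩
      have hw0 : w ≠ 0 := by
        rintro rfl
        exact z.ne_zero (by rw [hw, mul_zero])
      exact ⟨Units.mk0 w hw0, Units.ext (by simpa using hw)⟩
  rw [key, key, key, Units.val_mul, map_mul]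
  rcases quadraticChar_dichotomy x.ne_zero with hx | hx <;>
    rcases quadraticChar_dichotomy y.ne_zero with hy | hy <;> rw [hx, hy] <;> decide

lemma isSquare_map_conj_iff (x : Kˣ) : IsSquare (Units.map (conj : K →* K) x) ↔ IsSquare x := by
  constructor
  · intro h
    have h2 := h.map (Units.map (conj : K →* K))
    have : Units.map (conj : K →* K) (Units.map (conj : K →* K) x) = x := by
      ext
      simp [conj_conj]
    rwa [this] at h2
  · intro h
    exact h.map _

open scoped Classical in
lemma zassenhaus_mul (A B : GL (Fin 2) K) : ∃ C : GL (Fin 2) K, ∀ ω : Line,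
    C • twist C ω = A • twist A (B • twist B ω) := by
  by_cases hA : IsSquare (Matrix.GeneralLinearGroup.det A)
  · refine ⟨A * B, fun ω => ?_⟩
    have : twist (A * B) ω = twist B ω := by
      simp [twist, isSquare_mul_iff, hA]
    rw [this, mul_smul]
    congr 1
    simp [twist, hA]
  · refine ⟨A * B.map conj, fun ω => ?_⟩
    have hd : Matrix.GeneralLinearGroup.det (B.map conj) =
        Units.map (conj : K →* K) (Matrix.GeneralLinearGroup.det B) := by
      ext
      simp [Matrix.GeneralLinearGroup.map, RingHom.map_det]
    have : twist (A * B.map conj) ω = OnePoint.map conj (twist B ω) := by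
      by_cases hB : IsSquare (Matrix.GeneralLinearGroup.det B)
      · simp [twist, isSquare_mul_iff, hA, hd, hB, isSquare_map_conj_iff]
      · simp [twist, isSquare_mul_iff, hA, hd, hB, isSquare_map_conj_iff, map_conj_conj]
    rw [this, mul_smul, ← OnePoint.map_smul]
    congr 1
    simp [twist, hA]

open scoped Classical in
/-- The Zassenhaus group `M(3²)`: all permutations
`ω ↦ (a β(ω) + b) / (c β(ω) + d)` of `ℙ¹(K)`, where `ad - bc ≠ 0` and `β` is the identity if
`ad - bc` is a square in `Kˣ`, and `ω ↦ ω³` otherwise. -/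
def M9 : Subgroup (Equiv.Perm Line) where
  carrier := {h | ∃ A : GL (Fin 2) K, ∀ ω : Line, h ω = A • twist A ω}
  one_mem' := ⟨1, fun ω => by simp [twist]⟩
  mul_mem' := by
    rintro g h ⟨A, hA⟩ ⟨B, hB⟩
    obtain ⟨C, hC⟩ := zassenhaus_mul A B
    exact ⟨C, fun ω => by rw [hC, Equiv.Perm.mul_apply, hA, hB]⟩
  inv_mem' := by
    rintro g ⟨A, hA⟩
    by_cases h : IsSquare (Matrix.GeneralLinearGroup.det A)
    · refine ⟨A⁻¹, fun ω => ?_⟩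
      rw [Equiv.Perm.inv_eq_iff_eq, hA]
      simp [twist, h]
    · refine ⟨(A⁻¹).map conj, fun ω => ?_⟩
      have hd : Matrix.GeneralLinearGroup.det ((A⁻¹).map conj) =
          Units.map (conj : K →* K) (Matrix.GeneralLinearGroup.det A⁻¹) := by
        ext
        simp [Matrix.GeneralLinearGroup.map, RingHom.map_det]
      have h2 : ¬ IsSquare (Matrix.GeneralLinearGroup.det ((A⁻¹).map conj)) := by
        rw [hd, isSquare_map_conj_iff]
        simpa using h
      rw [Equiv.Perm.inv_eq_iff_eq, hA]
      simp only [twist, h, h2, if_false]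
      rw [← OnePoint.map_smul, map_conj_conj, smul_inv_smul]

/-- Coordinates on `K` with respect to the basis `1, ζ` over the prime field. -/
lemma bijective_coord (ζ : K) (hζ : ζ ^ 2 = 1 - ζ) : Function.Bijective
    (fun p : ZMod 3 × ZMod 3 => algebraMap (ZMod 3) K p.1 + ζ * algebraMap (ZMod 3) K p.2) := by
  have hc : Nat.card K = 9 := by
    have := GaloisField.card 3 2 (by norm_num)
    norm_num at this
    exact this
  rw [Nat.bijective_iff_injective_and_card]
  refine ⟨?_, by rw [hc]; simp⟩
  have hinj := (algebraMap (ZMod 3) K).injective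
  have hroot : ∀ c : ZMod 3, algebraMap (ZMod 3) K c ≠ ζ := by
    rintro c rfl
    have h : c ^ 2 = 1 - c := hinj (by simpa using hζ)
    have hall : ∀ d : ZMod 3, d ^ 2 ≠ 1 - d := by decide
    exact hall c h
  rintro ⟨a, b⟩ ⟨a', b'⟩ h
  simp only at h
  by_cases hb : b = b'
  · subst hb
    have := hinj (add_right_cancel h)
    rw [this]
  · exfalso
    have hne : algebraMap (ZMod 3) K (b - b') ≠ 0 := by
      rw [Ne, map_eq_zero]
      exact sub_ne_zero.mpr hb
    apply hroot ((a' - a) / (b - b'))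
    rw [map_div₀, div_eq_iff hne, map_sub, map_sub]
    linear_combination -h

/-- The bijection `(α, β) ↦ α + ζ β`. -/
def coord (ζ : K) (hζ : ζ ^ 2 = 1 - ζ) : ZMod 3 × ZMod 3 ≃ K :=
  Equiv.ofBijective _ (bijective_coord ζ hζ)

/-- The map `α + ζ β ↦ α - ζ β` of `K` onto itself (`α, β` in the prime field). -/
def reflect (ζ : K) (hζ : ζ ^ 2 = 1 - ζ) (x : K) : K :=
  coord ζ hζ (((coord ζ hζ).symm x).1, -((coord ζ hζ).symm x).2)

lemma reflect_apply (ζ : K) (hζ : ζ ^ 2 = 1 - ζ) (α β : ZMod 3) :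
    reflect ζ hζ (algebraMap (ZMod 3) K α + ζ * algebraMap (ZMod 3) K β) =
      algebraMap (ZMod 3) K α - ζ * algebraMap (ZMod 3) K β := by
  have h : algebraMap (ZMod 3) K α + ζ * algebraMap (ZMod 3) K β = coord ζ hζ (α, β) := rfl
  rw [h, reflect, Equiv.symm_apply_apply]
  simp [coord, sub_eq_add_neg]

lemma reflect_reflect (ζ : K) (hζ : ζ ^ 2 = 1 - ζ) (x : K) :
    reflect ζ hζ (reflect ζ hζ x) = x := by
  simp [reflect]

/-- The underlying map of `S₄`. -/
def s4Fun (ζ : K) (hζ : ζ ^ 2 = 1 - ζ) : Points → Points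
  | none => some OnePoint.infty
  | some OnePoint.infty => none
  | some (OnePoint.some x) => some (OnePoint.some (reflect ζ hζ x))

/-- The permutation `S₄` of the eleven points: it interchanges `v` and `∞`, and sends
`α + ζ β` to `α - ζ β`. -/
def S4 (ζ : K) (hζ : ζ ^ 2 = 1 - ζ) : Equiv.Perm Points :=
  Function.Involutive.toPerm (s4Fun ζ hζ) (by
    rintro (_ | _ | x)
    · rfl
    · rfl
    · exact congrArg (fun y : K => (some (OnePoint.some y) : Points)) (reflect_reflect ζ hζ x))

/-- The Mathieu group `M₁₁`, as a permutation group of degree eleven: the group generated by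
`M(3²)`, acting on the eleven points with `v` fixed, and `S₄`. -/
def M11 (ζ : K) (hζ : ζ ^ 2 = 1 - ζ) : Subgroup (Equiv.Perm Points) :=
  Subgroup.closure ({g | ∃ h ∈ M9, g = Equiv.optionCongr h} ∪ {S4 ζ hζ})

/-- The transformation `a : ω ↦ ζ⁻¹ ω³`, fixing `∞` and `v`. -/
def aMap (ζ : K) : Points → Points
  | none => none
  | some OnePoint.infty => some OnePoint.infty
  | some (OnePoint.some x) => some (OnePoint.some (ζ⁻¹ * x ^ 3))

/-- The transformation `T : ω ↦ 1 - ω`, fixing `∞` and `v`. -/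
def tMap : Points → Points
  | none => none
  | some OnePoint.infty => some OnePoint.infty
  | some (OnePoint.some x) => some (OnePoint.some (1 - x))

open scoped Classical in
/-- The transformation `J : ω ↦ ω⁻¹`, interchanging `0` and `∞` and fixing `v`. -/
def jMap : Points → Points
  | none => none
  | some OnePoint.infty => some (OnePoint.some 0)
  | some (OnePoint.some x) => if x = 0 then some OnePoint.infty else some (OnePoint.some x⁻¹)

/-- The four generating symbols. -/
inductive Gen : Type
  | a
  | T
  | J
  | U

/-- The commutator `[x, y] = x y x⁻¹ y⁻¹`. -/
def comm {G : Type*} [Group G] (x y : G) : G := x * y * x⁻¹ * y⁻¹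

/-- The conjugate `x ^ y = y⁻¹ x y`. -/
def conjBy {G : Type*} [Group G] (x y : G) : G := y⁻¹ * x * y

/-- The defining relators; a relation `x = y` is recorded as `x * y⁻¹`. The first set contains the
relators of `M(3²)`, the second one those involving `U`. -/
def rels : Set (FreeGroup Gen) :=
  let a := FreeGroup.of Gen.a
  let T := FreeGroup.of Gen.T
  let J := FreeGroup.of Gen.J
  let U := FreeGroup.of Gen.U
  {T ^ 2, J ^ 2, (J * T) ^ 3, (T * a ^ 2) ^ 3, comm J a ^ 4, (J * comm J a) ^ 2,
    a ^ 2 * (comm J a ^ 2)⁻¹, (a * T) ^ 2 * (conjBy T (comm J a))⁻¹} ∪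
  {U ^ 2, (U * T) ^ 2, (U * J) ^ 3, conjBy a U * (comm J a)⁻¹}

end Mathieu

end

/-!
The relations are checked on explicit permutations of the eleven points, so the presented group
acts on them. To see that this action is faithful, put `b = [J, a]` and consider the chain
`⟨b, a⟩ ≤ ⟨T, b, a⟩ ≤ ⟨J, T, b, a⟩ ≤ ⟨U, J, T, b, a⟩` in the presented group. The relations say that
`⟨b, a⟩` is a quotient of the quaternion group of order eight, and that each further term of the
chain is `H ∪ H s H`, where `H` is the previous term and `s = T, J, U` the new generator: for `T`
this is seen by rewriting `T q T` for all `q ∈ ⟨b, a⟩`, and for `J` and `U` it follows from the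
braid relations `J T J = T J T` and `U J U = J U J`. Since `s` moves a point fixed by `H`, the term
`H` is the stabilizer of that point in `H ∪ H s H`. An element acting trivially therefore descends
the chain to `⟨b, a⟩`, on which the action is faithful.

The image of `⟨J, T, b, a⟩` is contained in `M(3²)` and transitive on triples of distinct points of
`ℙ¹(K)`, whereas an element of `M(3²)` that fixes `∞`, `0` and `1` is trivial; hence that image is
`M(3²)`, and the image of the presented group is `M₁₁`.
-/

namespace Mathieu

section DoubleCoset

open Subgroup DoubleCoset

variable {G : Type*} [Group G]

/-- The set `H ∪ H s H`, named after the minimal parabolic subgroups `B ∪ B s B` of a group with a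
BN-pair; here it will be each subgroup of a chain of point stabilizers in terms of the previous
one. -/
def parabolicSet (H : Subgroup G) (s : G) : Set G := H ∪ doubleCoset s H H

theorem mul_mul_mem_parabolicSet {H : Subgroup G} {x y : G} (hx : x ∈ H) (s : G) (hy : y ∈ H) :
    x * s * y ∈ parabolicSet H s :=
  Or.inr (mem_doubleCoset.mpr ⟨x, hx, y, hy, rfl⟩)

theorem mem_parabolicSet_iff {H : Subgroup G} {s g : G} :
    g ∈ parabolicSet H s ↔ g ∈ H ∨ ∃ x ∈ H, ∃ y ∈ H, g = x * s * y :=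
  or_congr Iff.rfl mem_doubleCoset

theorem coe_closure_insert_eq {S : Set G} {s : G} (hs : s * s ∈ closure S)
    (hconj : ∀ x ∈ closure S, s * x * s ∈ parabolicSet (closure S) s) :
    (closure (insert s S) : Set G) = parabolicSet (closure S) s := by
  set H := closure S
  have hsub : H ≤ closure (insert s S) := closure_mono (Set.subset_insert s S)
  have hmem : s ∈ closure (insert s S) := subset_closure (Set.mem_insert s S)
  have mul_left : ∀ x ∈ H, ∀ y ∈ parabolicSet H s, x * y ∈ parabolicSet H s := by
    intro x hx y hy
    rcases mem_parabolicSet_iff.mp hy with hy | ⟨y₁, hy₁, y₂, hy₂, rfl⟩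
    · exact Or.inl (mul_mem hx hy)
    · rw [← mul_assoc, ← mul_assoc]
      exact mul_mul_mem_parabolicSet (mul_mem hx hy₁) s hy₂
  have mul_left_self : ∀ y ∈ parabolicSet H s, s * y ∈ parabolicSet H s := by
    intro y hy
    rcases mem_parabolicSet_iff.mp hy with hy | ⟨x, hx, z, hz, rfl⟩
    · simpa using mul_mul_mem_parabolicSet (one_mem H) s hy
    · rw [← mul_assoc, ← mul_assoc]
      rcases mem_parabolicSet_iff.mp (hconj x hx) with h | ⟨y₁, hy₁, y₂, hy₂, h⟩
      · exact Or.inl (mul_mem h hz)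
      · rw [h, mul_assoc]
        exact mul_mul_mem_parabolicSet hy₁ s (mul_mem hy₂ hz)
  apply Set.Subset.antisymm
  · intro g hg
    induction hg using closure_induction_left with
    | one => exact Or.inl (one_mem H)
    | mul_left x hx y _ ih =>
      rcases hx with rfl | hx
      · exact mul_left_self y ih
      · exact mul_left x (subset_closure hx) y ih
    | inv_mul_cancel x hx y _ ih =>
      rcases hx with rfl | hx
      · rw [show x⁻¹ * y = (x * x)⁻¹ * (x * y) by group]
        exact mul_left _ (inv_mem hs) _ (mul_left_self y ih)
      · exact mul_left x⁻¹ (inv_mem (subset_closure hx)) y ih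
  · intro g hg
    rcases mem_parabolicSet_iff.mp hg with hg | ⟨x, hx, y, hy, rfl⟩
    · exact hsub hg
    · exact mul_mem (mul_mem (hsub hx) hmem) (hsub hy)

-- The braid relation carries `t (x s y) t = (t x t) (t s t) (t y t)` into the double coset of `t`.
theorem coe_closure_insert_insert_eq {S : Set G} {s t : G}
    (hS : (closure (insert s S) : Set G) = parabolicSet (closure S) s)
    (ht : t * t = 1) (hbraid : t * s * t = s * t * s)
    (hconj : ∀ x ∈ closure S, t * x * t ∈ closure S) :
    (closure (insert t (insert s S)) : Set G) = parabolicSet (closure (insert s S)) t := by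
  have hsub : closure S ≤ closure (insert s S) := closure_mono (Set.subset_insert s S)
  have hs : s ∈ closure (insert s S) := subset_closure (Set.mem_insert s S)
  refine coe_closure_insert_eq (ht ▸ one_mem _) fun g hg => ?_
  rcases mem_parabolicSet_iff.mp (hS.subset hg) with hg | ⟨x, hx, y, hy, rfl⟩
  · exact Or.inl (hsub (hconj g hg))
  have ht_inv : t⁻¹ = t := inv_eq_of_mul_eq_one_left ht
  have heq : t * (x * s * y) * t = t * x * t * s * t * (s * (t * y * t)) := by
    calc t * (x * s * y) * t = t * x * t * (t⁻¹ * s * t⁻¹) * (t * y * t) := by group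
      _ = t * x * t * (s * t * s) * (t * y * t) := by rw [ht_inv, hbraid]
      _ = t * x * t * s * t * (s * (t * y * t)) := by group
  rw [heq]
  exact mul_mul_mem_parabolicSet (mul_mem (hsub (hconj x hx)) hs) t
    (mul_mem hs (hsub (hconj y hy)))

theorem conj_mem_closure {S : Set G} {s : G} (h : ∀ x ∈ S, s * x * s⁻¹ ∈ closure S) :
    ∀ x ∈ closure S, s * x * s⁻¹ ∈ closure S := by
  have hle : closure S ≤ (closure S).comap (MulAut.conj s).toMonoidHom := (closure_le _).mpr h
  exact hle

variable {α : Type*} [MulAction G α]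

theorem inf_stabilizer_le {H L : Subgroup G} {s : G} {x : α}
    (hL : (L : Set G) = parabolicSet H s) (hH : H ≤ MulAction.stabilizer G x)
    (hs : s • x ≠ x) : L ⊓ MulAction.stabilizer G x ≤ H := by
  rintro g ⟨hgL, hgx⟩
  rcases mem_parabolicSet_iff.mp (hL.subset hgL) with hg | ⟨y, hy, z, hz, rfl⟩
  · exact hg
  have hyx : y • x = x := hH hy
  have hzx : z • x = x := hH hz
  have hgx : (y * s * z) • x = x := hgx
  rw [mul_smul, mul_smul, hzx] at hgx
  exact absurd (smul_left_cancel y (hgx.trans hyx.symm)) hs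

end DoubleCoset

section Quaternion

open Subgroup

variable {G : Type*} [Group G] {a b q : G}

theorem exists_zpow_of_mem_closure_pair (hsq : b ^ 2 ∈ closure {a})
    (hconj : SemiconjBy b a a⁻¹) (hq : q ∈ closure {b, a}) :
    ∃ i : ℤ, q = a ^ i ∨ q = a ^ i * b := by
  have hconj_mem : ∀ x ∈ closure {a}, b * x * b ∈ closure {a} := by
    intro x hx
    obtain ⟨i, rfl⟩ := mem_closure_singleton.mp hx
    rw [(hconj.zpow_right i).eq, mul_assoc, ← sq]
    exact mul_mem (zpow_mem (inv_mem (mem_closure_singleton_self a)) i) hsq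
  have hunion := coe_closure_insert_eq (sq b ▸ hsq) fun x hx => Or.inl (hconj_mem x hx)
  rcases mem_parabolicSet_iff.mp (hunion.subset hq) with hq | ⟨x, hx, y, hy, rfl⟩
  · obtain ⟨i, rfl⟩ := mem_closure_singleton.mp hq
    exact ⟨i, Or.inl rfl⟩
  · obtain ⟨i, rfl⟩ := mem_closure_singleton.mp hx
    obtain ⟨j, rfl⟩ := mem_closure_singleton.mp hy
    refine ⟨i - j, Or.inr ?_⟩
    rw [mul_assoc, (hconj.zpow_right j).eq, inv_zpow', ← mul_assoc, ← zpow_add, sub_eq_add_neg]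

theorem zpow_eq_of_pow_four_eq_one (ha : a ^ 4 = 1) (i : ℤ) :
    a ^ i = 1 ∨ a ^ i = a ∨ a ^ i = a ^ 2 ∨ a ^ i = a⁻¹ := by
  have hcube : a ^ 3 = a⁻¹ := eq_inv_of_mul_eq_one_left (by rw [← pow_succ, ha])
  have hmod : a ^ i = a ^ (i % 4) := zpow_eq_zpow_emod' i ha
  rcases (by lia : i % 4 = 0 ∨ i % 4 = 1 ∨ i % 4 = 2 ∨ i % 4 = 3) with h | h | h | h <;>
    rw [hmod, h]
  · exact Or.inl (zpow_zero a)
  · exact Or.inr (Or.inl (zpow_one a))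
  · exact Or.inr (Or.inr (Or.inl (zpow_ofNat a 2)))
  · exact Or.inr (Or.inr (Or.inr ((zpow_ofNat a 3).trans hcube)))

theorem eq_or_eq_inv_of_mem_closure_pair (ha : a ^ 4 = 1) (hsq : b ^ 2 = a ^ 2)
    (hconj : SemiconjBy b a a⁻¹) (hq : q ∈ closure {b, a}) :
    ∃ x ∈ ({1, a ^ 2, a, b, a * b} : Set G), q = x ∨ q = x⁻¹ := by
  have hsq_mul : a ^ 2 * b = b⁻¹ := by
    rw [← hsq, eq_inv_iff_mul_eq_one, ← pow_succ, ← pow_succ, ← ha, pow_mul b 2 2, hsq, ← pow_mul]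
  have hinv_mul : a⁻¹ * b = (a * b)⁻¹ := by
    rw [eq_inv_iff_mul_eq_one]
    calc a⁻¹ * b * (a * b) = a⁻¹ * (b * a) * b := by group
      _ = (a ^ 2)⁻¹ * b ^ 2 := by simp only [hconj.eq, sq, mul_inv_rev, mul_assoc]
      _ = 1 := by rw [hsq, inv_mul_cancel]
  have hsq_mem : b ^ 2 ∈ closure {a} := hsq ▸ pow_mem (mem_closure_singleton_self a) 2
  obtain ⟨i, rfl | rfl⟩ := exists_zpow_of_mem_closure_pair hsq_mem hconj hq <;>
    rcases zpow_eq_of_pow_four_eq_one ha i with h | h | h | h <;> rw [h]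
  · exact ⟨1, by simp, by simp⟩
  · exact ⟨a, by simp, by simp⟩
  · exact ⟨a ^ 2, by simp, by simp⟩
  · exact ⟨a, by simp, by simp⟩
  · exact ⟨b, by simp, by simp⟩
  · exact ⟨a * b, by simp, by simp⟩
  · exact ⟨b, by simp, Or.inr hsq_mul⟩
  · exact ⟨a * b, by simp, Or.inr hinv_mul⟩

end Quaternion

section Tuples

open Subgroup

variable {G : Type*} [Group G] {a T J U : G}

/-- The relations of `M(3²)` for a triple of elements of a group. -/
structure IsZassenhausTuple (a T J : G) : Prop where
  T_sq : T ^ 2 = 1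
  J_sq : J ^ 2 = 1
  J_mul_T_pow : (J * T) ^ 3 = 1
  T_mul_a_sq_pow : (T * a ^ 2) ^ 3 = 1
  comm_pow : comm J a ^ 4 = 1
  J_mul_comm_sq : (J * comm J a) ^ 2 = 1
  a_sq : a ^ 2 = comm J a ^ 2
  a_mul_T_sq : (a * T) ^ 2 = conjBy T (comm J a)

/-- The defining relations of `M₁₁` for a quadruple of elements of a group. -/
structure IsMathieuTuple (a T J U : G) : Prop extends IsZassenhausTuple a T J where
  U_sq : U ^ 2 = 1
  U_mul_T_sq : (U * T) ^ 2 = 1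
  U_mul_J_pow : (U * J) ^ 3 = 1
  conjBy_U : conjBy a U = comm J a

theorem mul_mul_eq_of_mul_pow_three {x y : G} (hx : x ^ 2 = 1) (hy : y ^ 2 = 1)
    (hxy : (x * y) ^ 3 = 1) : x * y * x = y * x * y := by
  have hx' : x⁻¹ = x := inv_eq_of_mul_eq_one_left (sq x ▸ hx)
  have hy' : y⁻¹ = y := inv_eq_of_mul_eq_one_left (sq y ▸ hy)
  calc x * y * x = (x * y) ^ 3 * (y⁻¹ * x⁻¹ * y⁻¹) := by simp [pow_succ, mul_assoc]
    _ = y * x * y := by rw [hxy, one_mul, hx', hy']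

namespace IsZassenhausTuple

variable (h : IsZassenhausTuple a T J)
include h

theorem T_mul_T : T * T = 1 := sq T ▸ h.T_sq

theorem J_mul_J : J * J = 1 := sq J ▸ h.J_sq

theorem J_inv : J⁻¹ = J := inv_eq_of_mul_eq_one_left h.J_mul_J

theorem T_inv : T⁻¹ = T := inv_eq_of_mul_eq_one_left h.T_mul_T

theorem a_pow_four : a ^ 4 = 1 := by
  rw [pow_mul a 2 2, h.a_sq, ← pow_mul, h.comm_pow]

theorem conj_J_a : J * a * J = comm J a * a := by
  rw [comm, inv_mul_cancel_right, h.J_inv]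

theorem conj_J_comm : J * comm J a * J = (comm J a)⁻¹ := by
  rw [eq_inv_iff_mul_eq_one, ← h.J_mul_comm_sq, sq]
  group

theorem comm_semiconj_a : SemiconjBy (comm J a) a a⁻¹ := by
  have hconj_sq : J * a ^ 2 * J = a ^ 2 := by
    calc J * a ^ 2 * J = J * comm J a * (J * J) * comm J a * J := by
          rw [h.J_mul_J, h.a_sq, sq, mul_one]; group
      _ = (J * comm J a * J) ^ 2 := by rw [sq]; group
      _ = (a ^ 2)⁻¹ := by rw [h.conj_J_comm, inv_pow, h.a_sq]
      _ = a ^ 2 := by rw [inv_eq_iff_mul_eq_one, ← pow_add, h.a_pow_four]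
  have hmul_sq : (comm J a * a) ^ 2 = comm J a ^ 2 := by
    calc (comm J a * a) ^ 2 = J * a * (J * J) * a * J := by rw [← h.conj_J_a, sq]; group
      _ = J * a ^ 2 * J := by rw [h.J_mul_J, sq, mul_one]; group
      _ = comm J a ^ 2 := by rw [hconj_sq, h.a_sq]
  rw [sq, sq, mul_assoc, mul_right_inj, ← mul_assoc] at hmul_sq
  rw [SemiconjBy, eq_inv_mul_iff_mul_eq, ← mul_assoc, hmul_sq]

theorem conj_T_a_sq : T * a ^ 2 * T = a ^ 2 * T * a ^ 2 :=
  mul_mul_eq_of_mul_pow_three h.T_sq (by rw [← pow_mul, h.a_pow_four]) h.T_mul_a_sq_pow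

theorem conj_T_a : T * a * T = a⁻¹ * (comm J a)⁻¹ * T * comm J a := by
  have hsq : a * T * (a * T) = (comm J a)⁻¹ * T * comm J a := sq (a * T) ▸ h.a_mul_T_sq
  rw [mul_assoc a⁻¹, mul_assoc a⁻¹, ← hsq]
  group

theorem conj_T_comm : T * comm J a * T = comm J a * a * T * a := by
  have hsq : a * T * (a * T) = (comm J a)⁻¹ * T * comm J a := sq (a * T) ▸ h.a_mul_T_sq
  calc T * comm J a * T = comm J a * ((comm J a)⁻¹ * T * comm J a) * T := by group
    _ = comm J a * a * T * a * (T * T) := by rw [← hsq]; group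
    _ = comm J a * a * T * a := by rw [h.T_mul_T, mul_one]

theorem conj_T_a_mul_comm :
    T * (a * comm J a) * T = a⁻¹ * (comm J a)⁻¹ * (comm J a)⁻¹ * T * (comm J a * a * a) := by
  have ha : comm J a ^ 2 * a = a⁻¹ := by
    rw [← h.a_sq, eq_inv_iff_mul_eq_one, ← pow_succ, ← pow_succ, h.a_pow_four]
  have hinv : T * a⁻¹ * T = (comm J a)⁻¹ * T * (comm J a * a) := by
    calc T * a⁻¹ * T = (T * a * T)⁻¹ := by simp only [mul_inv_rev, h.T_inv, mul_assoc]
      _ = _ := by rw [h.conj_T_a]; simp only [mul_inv_rev, h.T_inv, inv_inv, mul_assoc]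
  calc T * (a * comm J a) * T = T * a * (T * T) * comm J a * T := by rw [h.T_mul_T]; group
    _ = (T * a * T) * (T * comm J a * T) := by group
    _ = a⁻¹ * (comm J a)⁻¹ * (T * (comm J a ^ 2 * a) * T) * a := by
      rw [h.conj_T_a, h.conj_T_comm, sq]; group
    _ = _ := by rw [ha, hinv]; simp only [mul_assoc]

theorem conj_T_mem {q : G} (hq : q ∈ closure {comm J a, a}) :
    T * q * T ∈ parabolicSet (closure {comm J a, a}) T := by
  set Q := closure {comm J a, a}
  have ha : a ∈ Q := subset_closure (by simp)
  have hb : comm J a ∈ Q := subset_closure (by simp)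
  have hinv : ∀ x, T * x * T ∈ parabolicSet Q T → T * x⁻¹ * T ∈ parabolicSet Q T := by
    intro x hx
    have hx_inv : T * x⁻¹ * T = (T * x * T)⁻¹ := by
      simp only [mul_inv_rev, h.T_inv, mul_assoc]
    rw [hx_inv]
    rcases mem_parabolicSet_iff.mp hx with hx | ⟨y, hy, z, hz, hyz⟩
    · exact Or.inl (inv_mem hx)
    · rw [hyz, mul_inv_rev, mul_inv_rev, h.T_inv, ← mul_assoc]
      exact mul_mul_mem_parabolicSet (inv_mem hz) T (inv_mem hy)
  obtain ⟨x, hx, hqx⟩ :=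
    eq_or_eq_inv_of_mem_closure_pair h.a_pow_four h.a_sq.symm h.comm_semiconj_a hq
  suffices hmem : T * x * T ∈ parabolicSet Q T by
    rcases hqx with rfl | rfl
    exacts [hmem, hinv x hmem]
  rcases hx with rfl | rfl | rfl | rfl | rfl
  · exact Or.inl (by rw [mul_one, h.T_mul_T]; exact one_mem Q)
  · rw [h.conj_T_a_sq]
    exact mul_mul_mem_parabolicSet (pow_mem ha 2) T (pow_mem ha 2)
  · rw [h.conj_T_a]
    exact mul_mul_mem_parabolicSet (mul_mem (inv_mem ha) (inv_mem hb)) T hb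
  · rw [h.conj_T_comm]
    exact mul_mul_mem_parabolicSet (mul_mem hb ha) T ha
  · rw [h.conj_T_a_mul_comm]
    exact mul_mul_mem_parabolicSet (mul_mem (mul_mem (inv_mem ha) (inv_mem hb)) (inv_mem hb)) T
      (mul_mem (mul_mem hb ha) ha)

theorem coe_closure_T : (closure {T, comm J a, a} : Set G) =
    parabolicSet (closure {comm J a, a}) T :=
  coe_closure_insert_eq (h.T_mul_T ▸ one_mem _) fun _ => h.conj_T_mem

theorem coe_closure_J : (closure {J, T, comm J a, a} : Set G) =
    parabolicSet (closure {T, comm J a, a}) J := by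
  refine coe_closure_insert_insert_eq h.coe_closure_T h.J_mul_J
    (mul_mul_eq_of_mul_pow_three h.J_sq h.T_sq h.J_mul_T_pow) ?_
  have ha : a ∈ closure {comm J a, a} := subset_closure (by simp)
  have hb : comm J a ∈ closure {comm J a, a} := subset_closure (by simp)
  suffices hconj : ∀ x ∈ closure {comm J a, a}, J * x * J⁻¹ ∈ closure {comm J a, a} by
    rwa [h.J_inv] at hconj
  refine conj_mem_closure ?_
  rintro x (rfl | rfl) <;> rw [h.J_inv]
  · exact h.conj_J_comm ▸ inv_mem hb
  · exact h.conj_J_a ▸ mul_mem hb ha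

end IsZassenhausTuple

theorem IsMathieuTuple.coe_closure_U (h : IsMathieuTuple a T J U) :
    (closure {U, J, T, comm J a, a} : Set G) =
      parabolicSet (closure {J, T, comm J a, a}) U := by
  have hUU : U * U = 1 := sq U ▸ h.U_sq
  have hU_inv : U⁻¹ = U := inv_eq_of_mul_eq_one_left hUU
  have hconj_a : U * a * U = comm J a := by
    have := h.conjBy_U
    rwa [conjBy, hU_inv] at this
  have hconj_comm : U * comm J a * U = a := by
    calc U * comm J a * U = U * U * a * (U * U) := by rw [← hconj_a]; group
      _ = a := by rw [hUU, one_mul, mul_one]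
  have hconj_T : U * T * U = T := by
    rw [← h.T_inv, eq_inv_iff_mul_eq_one, h.T_inv, mul_assoc, ← sq, h.U_mul_T_sq]
  refine coe_closure_insert_insert_eq h.coe_closure_J hUU
    (mul_mul_eq_of_mul_pow_three h.U_sq h.J_sq h.U_mul_J_pow) ?_
  suffices hconj : ∀ x ∈ closure {T, comm J a, a}, U * x * U⁻¹ ∈ closure {T, comm J a, a} by
    rwa [hU_inv] at hconj
  refine conj_mem_closure ?_
  rintro x (rfl | rfl | rfl) <;> rw [hU_inv] <;> apply Subgroup.subset_closure
  · simp [hconj_T]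
  · simp [hconj_comm]
  · simp [hconj_a]

end Tuples

section Presentation

variable {G : Type*} [Group G]

theorem forall_rels_iff {f : FreeGroup Gen →* G} :
    (∀ r ∈ rels, f r = 1) ↔
      IsMathieuTuple (f (.of .a)) (f (.of .T)) (f (.of .J)) (f (.of .U)) := by
  simp only [rels, comm, conjBy, Set.mem_union, Set.mem_insert_iff, Set.mem_singleton_iff, or_imp,
    forall_and, forall_eq, map_mul, map_pow, map_inv, mul_inv_eq_one]
  constructor
  · rintro ⟨⟨hT, hJ, hJT, hTa, hb, hJb, ha, haT⟩, hU, hUT, hUJ, hUa⟩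
    exact ⟨⟨hT, hJ, hJT, hTa, hb, hJb, ha, haT⟩, hU, hUT, hUJ, hUa⟩
  · rintro ⟨⟨hT, hJ, hJT, hTa, hb, hJb, ha, haT⟩, hU, hUT, hUJ, hUa⟩
    exact ⟨⟨hT, hJ, hJT, hTa, hb, hJb, ha, haT⟩, hU, hUT, hUJ, hUa⟩

/-- The generator of the presented group given by a generating symbol. -/
abbrev gen (x : Gen) : PresentedGroup rels := PresentedGroup.of x

theorem isMathieuTuple_gen : IsMathieuTuple (gen .a) (gen .T) (gen .J) (gen .U) :=
  forall_rels_iff.mp fun _ hr => PresentedGroup.one_of_mem hr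

/-- The subgroup `⟨[J, a], a⟩`, to be identified with the stabilizer of `v`, `∞` and `0`; it is a
quaternion group of order eight. -/
abbrev quaternionSubgroup : Subgroup (PresentedGroup rels) :=
  Subgroup.closure {comm (gen .J) (gen .a), gen .a}

/-- The subgroup `⟨T, [J, a], a⟩`, to be identified with the stabilizer of `v` and `∞`; it consists
of the transformations `ω ↦ r β(ω) + s`. -/
abbrev affineSubgroup : Subgroup (PresentedGroup rels) :=
  Subgroup.closure {gen .T, comm (gen .J) (gen .a), gen .a}

/-- The subgroup `⟨J, T, [J, a], a⟩`, to be identified with the stabilizer `M(3²)` of `v`. -/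
abbrev zassenhausSubgroup : Subgroup (PresentedGroup rels) :=
  Subgroup.closure {gen .J, gen .T, comm (gen .J) (gen .a), gen .a}

theorem quaternionSubgroup_le : quaternionSubgroup ≤ affineSubgroup :=
  Subgroup.closure_mono (Set.subset_insert _ _)

theorem affineSubgroup_le : affineSubgroup ≤ zassenhausSubgroup :=
  Subgroup.closure_mono (Set.subset_insert _ _)

theorem closure_gen_eq_top :
    Subgroup.closure {gen .U, gen .J, gen .T, comm (gen .J) (gen .a), gen .a} = ⊤ := by
  rw [eq_top_iff, ← PresentedGroup.closure_range_of, Subgroup.closure_le]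
  rintro _ ⟨x, rfl⟩
  cases x <;> exact Subgroup.subset_closure (by simp)

end Presentation

section Coordinates

/-- Coordinates of the elements `x + ζ y` of `K`. -/
abbrev Vec : Type := ZMod 3 × ZMod 3

/-- The eleven points in coordinates: `none` is `v`, `some none` is `∞`. -/
abbrev CoordPoint : Type := Option (Option Vec)

/-- The transformation `ω ↦ ζ⁻¹ ω³` in coordinates. -/
def aPerm : Equiv.Perm CoordPoint :=
  Equiv.optionCongr <| Equiv.optionCongr
    { toFun := fun p => (p.1 + p.2, p.1 - p.2)
      invFun := fun p => (-p.1 - p.2, p.2 - p.1)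
      left_inv := by decide
      right_inv := by decide }

/-- The transformation `ω ↦ 1 - ω` in coordinates. -/
def tPerm : Equiv.Perm CoordPoint :=
  Equiv.optionCongr <| Equiv.optionCongr <| (Equiv.subLeft 1).prodCongr (Equiv.neg _)

/-- The inversion `ω ↦ ω⁻¹` in coordinates. For `ω = x + ζ y` it is the product of the conjugate
`ω³ = (x - y) - ζ y` and the norm `ω⁴ = x² - x y - y²`, which is `1` or `-1`. -/
def coordInv (p : Vec) : Vec :=
  ((p.1 - p.2) * (p.1 ^ 2 - p.1 * p.2 - p.2 ^ 2), -p.2 * (p.1 ^ 2 - p.1 * p.2 - p.2 ^ 2))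

/-- The transformation `ω ↦ ω⁻¹` in coordinates. -/
def jPerm : Equiv.Perm CoordPoint :=
  Equiv.optionCongr <| Function.Involutive.toPerm
    (fun p : Option Vec => p.elim (some 0) fun p => if p = 0 then none else some (coordInv p))
    (by unfold Function.Involutive; decide)

/-- The permutation `S₄` in coordinates. -/
def uPerm : Equiv.Perm CoordPoint :=
  Equiv.swap none (some none) *
    Equiv.optionCongr (Equiv.optionCongr ((Equiv.refl _).prodCongr (Equiv.neg _)))

/-- The permutations attached to the generating symbols, in coordinates. -/
def genPerm : Gen → Equiv.Perm CoordPoint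
  | .a => aPerm
  | .T => tPerm
  | .J => jPerm
  | .U => uPerm

theorem isMathieuTuple_perm : IsMathieuTuple aPerm tPerm jPerm uPerm := by
  refine ⟨⟨?_, ?_, ?_, ?_, ?_, ?_, ?_, ?_⟩, ?_, ?_, ?_, ?_⟩ <;> decide +kernel

/-- The action of the presented group on the eleven points in coordinates. -/
def coordAction : PresentedGroup rels →* Equiv.Perm CoordPoint :=
  PresentedGroup.toGroup (f := genPerm) (forall_rels_iff.mpr isMathieuTuple_perm)

instance : MulAction (PresentedGroup rels) CoordPoint := MulAction.compHom _ coordAction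

theorem coordAction_gen (x : Gen) : coordAction (gen x) = genPerm x := PresentedGroup.toGroup.of _

theorem gen_smul (x : Gen) (p : CoordPoint) : gen x • p = genPerm x p :=
  DFunLike.congr_fun (coordAction_gen x) p

theorem coordAction_comm_gen (x y : Gen) :
    coordAction (comm (gen x) (gen y)) = comm (genPerm x) (genPerm y) := by
  simp only [comm, map_mul, map_inv, coordAction_gen]

theorem comm_gen_smul (x y : Gen) (p : CoordPoint) :
    comm (gen x) (gen y) • p = comm (genPerm x) (genPerm y) p :=
  DFunLike.congr_fun (coordAction_comm_gen x y) p

theorem zassenhausSubgroup_le_stabilizer :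
    zassenhausSubgroup ≤ MulAction.stabilizer _ (none : CoordPoint) := by
  rw [Subgroup.closure_le]
  rintro _ (rfl | rfl | rfl | rfl) <;>
    simp only [SetLike.mem_coe, MulAction.mem_stabilizer_iff, gen_smul, comm_gen_smul] <;> decide

theorem affineSubgroup_le_stabilizer :
    affineSubgroup ≤ MulAction.stabilizer _ (some none : CoordPoint) := by
  rw [Subgroup.closure_le]
  rintro _ (rfl | rfl | rfl) <;>
    simp only [SetLike.mem_coe, MulAction.mem_stabilizer_iff, gen_smul, comm_gen_smul] <;> decide

theorem quaternionSubgroup_le_stabilizer :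
    quaternionSubgroup ≤ MulAction.stabilizer _ (some (some 0) : CoordPoint) := by
  rw [Subgroup.closure_le]
  rintro _ (rfl | rfl) <;>
    simp only [SetLike.mem_coe, MulAction.mem_stabilizer_iff, gen_smul, comm_gen_smul] <;> decide

theorem stabilizer_le_zassenhausSubgroup :
    MulAction.stabilizer _ (none : CoordPoint) ≤ zassenhausSubgroup := by
  have hU : gen .U • (none : CoordPoint) ≠ none := by rw [gen_smul]; decide
  simpa only [closure_gen_eq_top, top_inf_eq] using
    inf_stabilizer_le isMathieuTuple_gen.coe_closure_U zassenhausSubgroup_le_stabilizer hU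

theorem inf_stabilizer_le_affineSubgroup :
    zassenhausSubgroup ⊓ MulAction.stabilizer _ (some none : CoordPoint) ≤ affineSubgroup := by
  have hJ : gen .J • (some none : CoordPoint) ≠ some none := by rw [gen_smul]; decide
  exact inf_stabilizer_le isMathieuTuple_gen.coe_closure_J affineSubgroup_le_stabilizer hJ

theorem inf_stabilizer_le_quaternionSubgroup :
    affineSubgroup ⊓ MulAction.stabilizer _ (some (some 0) : CoordPoint) ≤ quaternionSubgroup := by
  have hT : gen .T • (some (some 0) : CoordPoint) ≠ some (some 0) := by rw [gen_smul]; decide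
  exact inf_stabilizer_le isMathieuTuple_gen.coe_closure_T quaternionSubgroup_le_stabilizer hT

theorem eq_one_of_mem_quaternionSubgroup {q : PresentedGroup rels} (hq : q ∈ quaternionSubgroup)
    (hfix : coordAction q (some (some (1, 0))) = some (some (1, 0))) : q = 1 := by
  have h := isMathieuTuple_gen.toIsZassenhausTuple
  obtain ⟨x, rfl | rfl | rfl | rfl | rfl, rfl | rfl⟩ :=
    eq_or_eq_inv_of_mem_closure_pair h.a_pow_four h.a_sq.symm h.comm_semiconj_a hq
  · rfl
  · exact inv_one
  all_goals
    simp only [map_inv, map_mul, map_pow, coordAction_comm_gen, coordAction_gen, genPerm] at hfix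
    exact absurd hfix (by decide)

theorem coordAction_injective : Function.Injective coordAction := by
  rw [injective_iff_map_eq_one]
  intro g hg
  have hfix : ∀ p, g ∈ MulAction.stabilizer (PresentedGroup rels) (p : CoordPoint) :=
    fun p => DFunLike.congr_fun hg p
  have hzassenhaus := stabilizer_le_zassenhausSubgroup (hfix none)
  have haffine := inf_stabilizer_le_affineSubgroup ⟨hzassenhaus, hfix _⟩
  have hquaternion := inf_stabilizer_le_quaternionSubgroup ⟨haffine, hfix _⟩
  exact eq_one_of_mem_quaternionSubgroup hquaternion (hfix _)

end Coordinates

section Transitivity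

theorem exists_mem_quaternionSubgroup_smul_eq {p : Vec} (hp : p ≠ 0) :
    ∃ q ∈ quaternionSubgroup, q • (some (some p) : CoordPoint) = some (some (1, 0)) := by
  have hperm : ∀ p : Vec, p ≠ 0 → ∃ i : Fin 4, ∃ j : Fin 2,
      (aPerm ^ (i : ℕ) * comm jPerm aPerm ^ (j : ℕ)) (some (some p)) = some (some (1, 0)) := by
    decide
  obtain ⟨i, j, hij⟩ := hperm p hp
  refine ⟨gen .a ^ (i : ℕ) * comm (gen .J) (gen .a) ^ (j : ℕ), ?_, ?_⟩
  · exact mul_mem (pow_mem (Subgroup.subset_closure (by simp)) _)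
      (pow_mem (Subgroup.subset_closure (by simp)) _)
  · have hmap : coordAction (gen .a ^ (i : ℕ) * comm (gen .J) (gen .a) ^ (j : ℕ)) =
        aPerm ^ (i : ℕ) * comm jPerm aPerm ^ (j : ℕ) := by
      simp only [map_mul, map_pow, coordAction_comm_gen, coordAction_gen, genPerm]
    exact (DFunLike.congr_fun hmap _).trans hij

theorem exists_smul_some_eq {g : PresentedGroup rels} (hg : g ∈ zassenhausSubgroup)
    (p : Option Vec) : ∃ q : Option Vec, g • (some p : CoordPoint) = some q := by
  have hg_none : g • (none : CoordPoint) = none := zassenhausSubgroup_le_stabilizer hg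
  rw [← Option.ne_none_iff_exists', ← hg_none]
  exact (MulAction.injective g).ne (Option.some_ne_none p)

theorem exists_mem_affineSubgroup_smul_eq {p q : Vec} (hpq : p ≠ q) :
    ∃ b ∈ affineSubgroup, b • (some (some p) : CoordPoint) = some (some 0) ∧
      b • (some (some q) : CoordPoint) = some (some (1, 0)) := by
  have exists_zero : ∀ p : Vec, ∃ b ∈ affineSubgroup,
      b • (some (some p) : CoordPoint) = some (some 0) := by
    intro p
    rcases eq_or_ne p 0 with rfl | hp
    · exact ⟨1, one_mem _, one_smul _ _⟩
    obtain ⟨c, hc, hcp⟩ := exists_mem_quaternionSubgroup_smul_eq hp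
    refine ⟨gen .T * c, mul_mem (Subgroup.subset_closure (by simp)) (quaternionSubgroup_le hc), ?_⟩
    rw [mul_smul, hcp, gen_smul]
    decide
  obtain ⟨b, hb, hbp⟩ := exists_zero p
  have hb_infty : b • (some none : CoordPoint) = some none := affineSubgroup_le_stabilizer hb
  obtain ⟨r, hr⟩ := exists_smul_some_eq (affineSubgroup_le hb) (some q)
  obtain ⟨q', rfl⟩ : ∃ q', r = some q' := by
    rw [← Option.ne_none_iff_exists']
    rintro rfl
    simpa using smul_left_cancel b (hr.trans hb_infty.symm)
  have hq' : q' ≠ 0 := by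
    rintro rfl
    simpa [hpq] using smul_left_cancel b (hbp.trans hr.symm)
  obtain ⟨c, hc, hcq⟩ := exists_mem_quaternionSubgroup_smul_eq hq'
  have hc_zero : c • (some (some 0) : CoordPoint) = some (some 0) :=
    quaternionSubgroup_le_stabilizer hc
  exact ⟨c * b, mul_mem (quaternionSubgroup_le hc) hb, by rw [mul_smul, hbp, hc_zero],
    by rw [mul_smul, hr, hcq]⟩

theorem exists_mem_zassenhausSubgroup_smul_eq {p q r : Option Vec} (hpq : p ≠ q) (hpr : p ≠ r)
    (hqr : q ≠ r) :
    ∃ g ∈ zassenhausSubgroup, g • (some p : CoordPoint) = some none ∧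
      g • (some q : CoordPoint) = some (some 0) ∧
      g • (some r : CoordPoint) = some (some (1, 0)) := by
  have exists_infty : ∀ p : Option Vec, ∃ g ∈ zassenhausSubgroup,
      g • (some p : CoordPoint) = some none := by
    rintro (_ | p)
    · exact ⟨1, one_mem _, one_smul _ _⟩
    obtain ⟨b, hb, hbp, -⟩ := exists_mem_affineSubgroup_smul_eq (p := p) (q := p + 1) (by simp)
    refine ⟨gen .J * b, mul_mem (Subgroup.subset_closure (by simp)) (affineSubgroup_le hb), ?_⟩
    rw [mul_smul, hbp, gen_smul]
    decide
  obtain ⟨g, hg, hgp⟩ := exists_infty p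
  have exists_affine : ∀ s, p ≠ s → ∃ s' : Vec, g • (some s : CoordPoint) = some (some s') := by
    intro s hps
    obtain ⟨t, ht⟩ := exists_smul_some_eq hg s
    obtain ⟨s', rfl⟩ : ∃ s', t = some s' := by
      rw [← Option.ne_none_iff_exists']
      rintro rfl
      exact hps (Option.some_injective _ (smul_left_cancel g (hgp.trans ht.symm)))
    exact ⟨s', ht⟩
  obtain ⟨q', hq'⟩ := exists_affine q hpq
  obtain ⟨r', hr'⟩ := exists_affine r hpr
  have hne : q' ≠ r' := by
    rintro rfl
    exact hqr (Option.some_injective _ (smul_left_cancel g (hq'.trans hr'.symm)))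
  obtain ⟨b, hb, hbq, hbr⟩ := exists_mem_affineSubgroup_smul_eq hne
  have hb_infty : b • (some none : CoordPoint) = some none := affineSubgroup_le_stabilizer hb
  exact ⟨b * g, mul_mem (affineSubgroup_le hb) hg, by rw [mul_smul, hgp, hb_infty],
    by rw [mul_smul, hq', hbq], by rw [mul_smul, hr', hbr]⟩

end Transitivity

section ProjectiveLine

open OnePoint

variable {F : Type*} [Field F] [DecidableEq F]

theorem scalar_smul (u : Fˣ) (ω : OnePoint F) :
    Matrix.GeneralLinearGroup.scalar (Fin 2) u • ω = ω := by
  cases ω with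
  | infty => rw [smul_infty_eq_self_iff]; simp
  | coe x => simp [smul_some_eq_ite]

theorem eq_scalar_of_smul_eq {A : GL (Fin 2) F} (h_infty : A • (∞ : OnePoint F) = ∞)
    (h_zero : A • ((0 : F) : OnePoint F) = (0 : F)) (h_one : A • ((1 : F) : OnePoint F) = (1 : F)) :
    ∃ u : Fˣ, A = Matrix.GeneralLinearGroup.scalar (Fin 2) u := by
  rw [smul_infty_eq_self_iff] at h_infty
  have h11 : A 1 1 ≠ 0 := by
    have := A.det_ne_zero
    rw [Matrix.det_fin_two, h_infty, mul_zero, sub_zero] at this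
    exact right_ne_zero_of_mul this
  simp only [smul_some_eq_ite, h_infty, zero_add, mul_zero, if_neg h11, coe_eq_coe,
    div_eq_zero_iff, or_iff_left h11] at h_zero
  simp only [smul_some_eq_ite, h_infty, h_zero, zero_add, mul_one, add_zero, if_neg h11,
    coe_eq_coe, div_eq_one_iff_eq h11] at h_one
  refine ⟨Units.mk0 _ h11, Units.ext ?_⟩
  ext i j
  fin_cases i <;> fin_cases j <;> simp [h_infty, h_zero, h_one]

open scoped Classical in
theorem smul_twist_eq_self {A : GL (Fin 2) K} (h_infty : A • twist A ∞ = ∞)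
    (h_zero : A • twist A (0 : K) = (0 : K)) (h_one : A • twist A (1 : K) = (1 : K)) (ω : Line) :
    A • twist A ω = ω := by
  have htwist : twist A ∞ = ∞ ∧ twist A (0 : K) = (0 : K) ∧ twist A (1 : K) = (1 : K) := by
    unfold twist
    split_ifs <;> simp
  rw [htwist.1] at h_infty
  rw [htwist.2.1] at h_zero
  rw [htwist.2.2] at h_one
  obtain ⟨u, rfl⟩ := eq_scalar_of_smul_eq h_infty h_zero h_one
  have hsquare : IsSquare
      (Matrix.GeneralLinearGroup.det (Matrix.GeneralLinearGroup.scalar (Fin 2) u)) := by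
    rw [Matrix.GeneralLinearGroup.det_scalar, Fintype.card_fin]
    exact IsSquare.sq u
  rw [twist, if_pos hsquare, scalar_smul]

end ProjectiveLine

section FieldOfNine

variable {ζ : K}

theorem three_eq_zero : (3 : K) = 0 := by exact_mod_cast CharP.cast_eq_zero K 3

theorem zeta_ne_zero (hζ : ζ ^ 2 = 1 - ζ) : ζ ≠ 0 := by
  rintro rfl
  simp at hζ

theorem zeta_pow_four (hζ : ζ ^ 2 = 1 - ζ) : ζ ^ 4 = -1 := by
  linear_combination (ζ ^ 2 - ζ + 2) * hζ - (ζ - 1) * three_eq_zero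

theorem isSquare_neg_one (hζ : ζ ^ 2 = 1 - ζ) : IsSquare (-1 : Kˣ) := by
  refine ⟨Units.mk0 ζ (zeta_ne_zero hζ) ^ 2, Units.ext ?_⟩
  rw [← pow_add]
  exact (zeta_pow_four hζ).symm

theorem not_isSquare_of_pow_four_eq_neg_one {u : Kˣ} (hu : (u : K) ^ 4 = -1) : ¬IsSquare u := by
  rintro ⟨w, rfl⟩
  have : Fintype K := Fintype.ofFinite K
  have hcard : Fintype.card K = 9 := by
    rw [← Nat.card_eq_fintype_card, GaloisField.card 3 2 (by norm_num)]
    norm_num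
  have hw : (w : K) ^ 8 = 1 := by
    simpa only [hcard] using FiniteField.pow_card_sub_one_eq_one (w : K) w.ne_zero
  push_cast at hu
  have hneg : (1 : K) = -1 := by linear_combination hu - hw
  exact one_ne_zero (α := K) (by linear_combination three_eq_zero - hneg)

variable (hζ : ζ ^ 2 = 1 - ζ)

theorem coord_apply (p : Vec) :
    coord ζ hζ p = algebraMap (ZMod 3) K p.1 + ζ * algebraMap (ZMod 3) K p.2 := rfl

theorem coord_zero : coord ζ hζ 0 = 0 := by simp [coord_apply]

theorem coord_one : coord ζ hζ (1, 0) = 1 := by simp [coord_apply]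

theorem coord_eq_zero_iff {p : Vec} : coord ζ hζ p = 0 ↔ p = 0 := by
  rw [← coord_zero hζ, EmbeddingLike.apply_eq_iff_eq]

theorem zeta_inv_mul_coord_pow_three (p : Vec) :
    ζ⁻¹ * coord ζ hζ p ^ 3 = coord ζ hζ (p.1 + p.2, p.1 - p.2) := by
  have hcube : coord ζ hζ p ^ 3 =
      algebraMap (ZMod 3) K p.1 + ζ ^ 3 * algebraMap (ZMod 3) K p.2 := by
    rw [coord_apply, add_pow_char, mul_pow, ← map_pow, ← map_pow, ZMod.pow_card, ZMod.pow_card]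
  rw [inv_mul_eq_iff_eq_mul₀ (zeta_ne_zero hζ), hcube]
  simp only [coord_apply, map_add, map_sub]
  linear_combination (ζ * algebraMap (ZMod 3) K p.2 - algebraMap (ZMod 3) K p.1) * hζ

theorem one_sub_coord (p : Vec) : 1 - coord ζ hζ p = coord ζ hζ (1 - p.1, -p.2) := by
  simp only [coord_apply, map_neg, map_sub, map_one]
  ring

theorem coord_inv {p : Vec} (hp : p ≠ 0) : (coord ζ hζ p)⁻¹ = coord ζ hζ (coordInv p) := by
  have hnorm : ∀ p : Vec, p ≠ 0 → (p.1 ^ 2 - p.1 * p.2 - p.2 ^ 2) ^ 2 = 1 := by decide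
  have hnorm_p := congrArg (algebraMap (ZMod 3) K) (hnorm p hp)
  apply inv_eq_of_mul_eq_one_right
  simp only [coordInv, coord_apply, map_neg, map_sub, map_mul, map_pow, map_one] at hnorm_p ⊢
  set x := algebraMap (ZMod 3) K p.1
  set y := algebraMap (ZMod 3) K p.2
  linear_combination hnorm_p - y ^ 2 * (x ^ 2 - x * y - y ^ 2) * hζ

end FieldOfNine

section Action

variable (ζ : K) (hζ : ζ ^ 2 = 1 - ζ)

/-- The bijection from coordinates to the points of the projective line; `none` goes to `∞`. -/
noncomputable def lineEquiv : Option Vec ≃ Line := Equiv.optionCongr (coord ζ hζ)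

/-- The bijection from coordinates to the eleven points. -/
noncomputable def pointEquiv : CoordPoint ≃ Points := Equiv.optionCongr (lineEquiv ζ hζ)

theorem aMap_pointEquiv (p : CoordPoint) :
    aMap ζ (pointEquiv ζ hζ p) = pointEquiv ζ hζ (aPerm p) := by
  rcases p with _ | _ | p
  · rfl
  · rfl
  · exact congrArg (fun x : K => (some (OnePoint.some x) : Points))
      (zeta_inv_mul_coord_pow_three hζ p)

theorem tMap_pointEquiv (p : CoordPoint) :
    tMap (pointEquiv ζ hζ p) = pointEquiv ζ hζ (tPerm p) := by
  rcases p with _ | _ | p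
  · rfl
  · rfl
  · exact congrArg (fun x : K => (some (OnePoint.some x) : Points)) (one_sub_coord hζ p)

open scoped Classical in
theorem jMap_pointEquiv (p : CoordPoint) :
    jMap (pointEquiv ζ hζ p) = pointEquiv ζ hζ (jPerm p) := by
  rcases p with _ | _ | p
  · rfl
  · exact congrArg (fun x : K => (some (OnePoint.some x) : Points)) (coord_zero hζ).symm
  · change (if coord ζ hζ p = 0 then some OnePoint.infty else
      some (OnePoint.some (coord ζ hζ p)⁻¹) : Points) =
        pointEquiv ζ hζ (some (if p = 0 then none else some (coordInv p)))
    simp only [coord_eq_zero_iff]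
    split_ifs with hp
    · rfl
    · rw [coord_inv hζ hp]
      rfl

theorem S4_pointEquiv (p : CoordPoint) :
    S4 ζ hζ (pointEquiv ζ hζ p) = pointEquiv ζ hζ (uPerm p) := by
  rcases p with _ | _ | p
  · rfl
  · rfl
  · refine congrArg (fun x : K => (some (OnePoint.some x) : Points)) ?_
    simp [reflect, Prod.map]

/-- The action of the presented group on the eleven points. -/
noncomputable def action : PresentedGroup rels →* Equiv.Perm Points :=
  (pointEquiv ζ hζ).permCongrHom.toMonoidHom.comp coordAction

theorem action_pointEquiv (g : PresentedGroup rels) (p : CoordPoint) :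
    action ζ hζ g (pointEquiv ζ hζ p) = pointEquiv ζ hζ (g • p) := by
  change pointEquiv ζ hζ (coordAction g ((pointEquiv ζ hζ).symm (pointEquiv ζ hζ p))) = _
  rw [Equiv.symm_apply_apply]
  rfl

theorem action_injective : Function.Injective (action ζ hζ) :=
  (pointEquiv ζ hζ).permCongrHom.injective.comp coordAction_injective

variable {ζ} in
theorem action_gen_apply {f : Points → Points} {x : Gen}
    (hf : ∀ p, f (pointEquiv ζ hζ p) = pointEquiv ζ hζ (genPerm x p)) (ω : Points) :
    action ζ hζ (gen x) ω = f ω := by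
  obtain ⟨p, rfl⟩ := (pointEquiv ζ hζ).surjective ω
  rw [action_pointEquiv, gen_smul, hf]

theorem action_a (ω : Points) : action ζ hζ (gen .a) ω = aMap ζ ω :=
  action_gen_apply hζ (aMap_pointEquiv ζ hζ) ω

theorem action_T (ω : Points) : action ζ hζ (gen .T) ω = tMap ω :=
  action_gen_apply hζ (tMap_pointEquiv ζ hζ) ω

theorem action_J (ω : Points) : action ζ hζ (gen .J) ω = jMap ω :=
  action_gen_apply hζ (jMap_pointEquiv ζ hζ) ω

theorem action_U : action ζ hζ (gen .U) = S4 ζ hζ :=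
  Equiv.ext (action_gen_apply hζ (S4_pointEquiv ζ hζ))

end Action

section Image

open OnePoint hiding some
open Matrix.GeneralLinearGroup

/-- The extension of permutations of the projective line to the eleven points. -/
def extendHom : Equiv.Perm Line →* Equiv.Perm Points :=
  MonoidHom.mk' Equiv.optionCongr fun g h => Equiv.optionCongr_trans h g

theorem extendHom_some (h : Equiv.Perm Line) (ω : Line) : extendHom h (some ω) = some (h ω) := rfl

open scoped Classical in
theorem mem_map_extendHom_M9 {g : Equiv.Perm Points} (A : GL (Fin 2) K) (hg_none : g none = none)
    (hg : ∀ ω : Line, g (some ω) = some (A • twist A ω)) : g ∈ M9.map extendHom := by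
  have hremove : ∀ ω, Equiv.removeNone g ω = A • twist A ω := fun ω =>
    Option.some_injective _ ((Equiv.removeNone_some g ⟨_, hg ω⟩).trans (hg ω))
  refine ⟨Equiv.removeNone g, ⟨A, hremove⟩, Equiv.ext ?_⟩
  rintro (_ | ω)
  · exact hg_none.symm
  · rw [extendHom_some, hremove, hg]

theorem eq_one_of_mem_M9 {h : Equiv.Perm Line} (hh : h ∈ M9) (h_infty : h ∞ = ∞)
    (h_zero : h (0 : K) = (0 : K)) (h_one : h (1 : K) = (1 : K)) : h = 1 := by
  obtain ⟨A, hA⟩ := hh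
  rw [hA] at h_infty h_zero h_one
  exact Equiv.ext fun ω => (hA ω).trans (smul_twist_eq_self h_infty h_zero h_one ω)

variable (ζ : K) (hζ : ζ ^ 2 = 1 - ζ)

open scoped Classical in
theorem action_a_mem : action ζ hζ (gen .a) ∈ M9.map extendHom := by
  have hdet : (!![ζ⁻¹, 0; 0, 1] : Matrix (Fin 2) (Fin 2) K).det ≠ 0 := by
    simpa [Matrix.det_fin_two] using zeta_ne_zero hζ
  have hsquare : ¬IsSquare (mkOfDetNeZero _ hdet).det := by
    apply not_isSquare_of_pow_four_eq_neg_one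
    simp [mkOfDetNeZero, Matrix.det_fin_two, zeta_pow_four hζ, inv_neg]
  refine mem_map_extendHom_M9 (mkOfDetNeZero _ hdet) (action_a ζ hζ none) fun ω => ?_
  rw [action_a, twist, if_neg hsquare]
  induction ω using OnePoint.rec with
  | infty => simp [mkOfDetNeZero, smul_infty_eq_ite, aMap]
  | coe x => simp [mkOfDetNeZero, smul_some_eq_ite, aMap, conj, frobenius_def]

open scoped Classical in
theorem action_T_mem : action ζ hζ (gen .T) ∈ M9.map extendHom := by
  have hdet : (!![-1, 1; 0, 1] : Matrix (Fin 2) (Fin 2) K).det ≠ 0 := by simp [Matrix.det_fin_two]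
  have hsquare : IsSquare (mkOfDetNeZero _ hdet).det := by
    convert isSquare_neg_one hζ
    ext
    simp [mkOfDetNeZero, Matrix.det_fin_two]
  refine mem_map_extendHom_M9 (mkOfDetNeZero _ hdet) (action_T ζ hζ none) fun ω => ?_
  rw [action_T, twist, if_pos hsquare]
  induction ω using OnePoint.rec with
  | infty => simp [mkOfDetNeZero, smul_infty_eq_ite, tMap]
  | coe x => simp [mkOfDetNeZero, smul_some_eq_ite, tMap, sub_eq_neg_add]

open scoped Classical in
theorem action_J_mem : action ζ hζ (gen .J) ∈ M9.map extendHom := by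
  have hdet : (!![0, 1; 1, 0] : Matrix (Fin 2) (Fin 2) K).det ≠ 0 := by simp [Matrix.det_fin_two]
  have hsquare : IsSquare (mkOfDetNeZero _ hdet).det := by
    convert isSquare_neg_one hζ
    ext
    simp [mkOfDetNeZero, Matrix.det_fin_two]
  refine mem_map_extendHom_M9 (mkOfDetNeZero _ hdet) (action_J ζ hζ none) fun ω => ?_
  rw [action_J, twist, if_pos hsquare]
  induction ω using OnePoint.rec with
  | infty => simp [mkOfDetNeZero, smul_infty_eq_ite, jMap]
  | coe x =>
    simp only [mkOfDetNeZero, smul_some_eq_ite, jMap]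
    by_cases hx : x = 0 <;> simp [hx]

theorem map_zassenhausSubgroup_le : zassenhausSubgroup.map (action ζ hζ) ≤ M9.map extendHom := by
  rw [Subgroup.map_le_iff_le_comap, Subgroup.closure_le]
  have ha : gen .a ∈ (M9.map extendHom).comap (action ζ hζ) := action_a_mem ζ hζ
  have hJ : gen .J ∈ (M9.map extendHom).comap (action ζ hζ) := action_J_mem ζ hζ
  rintro _ (rfl | rfl | rfl | rfl)
  · exact hJ
  · exact action_T_mem ζ hζ
  · exact mul_mem (mul_mem (mul_mem hJ ha) (inv_mem hJ)) (inv_mem ha)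
  · exact ha

theorem map_zassenhausSubgroup : zassenhausSubgroup.map (action ζ hζ) = M9.map extendHom := by
  refine le_antisymm (map_zassenhausSubgroup_le ζ hζ) ?_
  rintro _ ⟨h, hh, rfl⟩
  have hinj := (lineEquiv ζ hζ).symm.injective.comp h.injective
  obtain ⟨g, hg, hg_infty, hg_zero, hg_one⟩ := exists_mem_zassenhausSubgroup_smul_eq
    (hinj.ne (infty_ne_coe (0 : K))) (hinj.ne (infty_ne_coe (1 : K)))
    (hinj.ne (coe_injective.ne zero_ne_one))
  obtain ⟨k, hk, hkg⟩ := map_zassenhausSubgroup_le ζ hζ ⟨g, hg, rfl⟩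
  have hkh : ∀ ω (q : Option Vec),
      g • (some (((lineEquiv ζ hζ).symm ∘ h) ω) : CoordPoint) = some q →
        (k * h) ω = lineEquiv ζ hζ q := by
    intro ω q hq
    apply Option.some_injective
    have hω : (some (h ω) : Points) =
        pointEquiv ζ hζ (some (((lineEquiv ζ hζ).symm ∘ h) ω)) :=
      congrArg some ((lineEquiv ζ hζ).apply_symm_apply (h ω)).symm
    rw [Equiv.Perm.mul_apply, ← extendHom_some, hkg, hω, action_pointEquiv, hq]
    rfl
  have hone : k * h = 1 := eq_one_of_mem_M9 (mul_mem hk hh) (hkh _ _ hg_infty)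
    ((hkh _ _ hg_zero).trans (congrArg OnePoint.some (coord_zero hζ)))
    ((hkh _ _ hg_one).trans (congrArg OnePoint.some (coord_one hζ)))
  refine ⟨g⁻¹, inv_mem hg, ?_⟩
  rw [map_inv, ← hkg, ← map_inv, inv_eq_of_mul_eq_one_right hone]

theorem range_action : (action ζ hζ).range = M11 ζ hζ := by
  have hM9 : {g | ∃ h ∈ M9, g = Equiv.optionCongr h} = (M9.map extendHom : Set _) :=
    Set.ext fun g => exists_congr fun h => and_congr_right fun _ => eq_comm
  rw [M11, hM9, ← map_zassenhausSubgroup ζ hζ, Subgroup.closure_union, Subgroup.closure_eq,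
    ← action_U, ← Set.image_singleton, ← MonoidHom.map_closure, ← Subgroup.map_sup, sup_comm,
    ← Subgroup.closure_union, Set.singleton_union, closure_gen_eq_top, MonoidHom.range_eq_map]

end Image

end Mathieu

theorem proposition7p3 (ζ : Mathieu.K) (hζ : ζ ^ 2 = 1 - ζ) :
    ∃ φ : PresentedGroup Mathieu.rels ≃* Mathieu.M11 ζ hζ,
      (∀ ω, (φ (PresentedGroup.of Mathieu.Gen.a) : Equiv.Perm Mathieu.Points) ω =
        Mathieu.aMap ζ ω) ∧
      (∀ ω, (φ (PresentedGroup.of Mathieu.Gen.T) : Equiv.Perm Mathieu.Points) ω =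
        Mathieu.tMap ω) ∧
      (∀ ω, (φ (PresentedGroup.of Mathieu.Gen.J) : Equiv.Perm Mathieu.Points) ω =
        Mathieu.jMap ω) ∧
      (φ (PresentedGroup.of Mathieu.Gen.U) : Equiv.Perm Mathieu.Points) = Mathieu.S4 ζ hζ :=
  ⟨(MonoidHom.ofInjective (Mathieu.action_injective ζ hζ)).trans
      (MulEquiv.subgroupCongr (Mathieu.range_action ζ hζ)),
    Mathieu.action_a ζ hζ, Mathieu.action_T ζ hζ, Mathieu.action_J ζ hζ, Mathieu.action_U ζ hζ⟩
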